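/- Let $f:\mathbb{R}^{d_1}\times\mathbb{R}^{d_2}\to\mathbb{R}$ be differentiable and suppose that, for constants $l\ge\mu>0$: (i) $\|\nabla_x f(x_1,y_1)-\nabla_x f(x_2,y_2)\|\le l\,[\|x_1-x_2\|+\|y_1-y_2\|]$ and $\|\nabla_y f(x_1,y_1)-\nabla_y f(x_2,y_2)\|\le l\,[\|x_1-x_2\|+\|y_1-y_2\|]$ for all $x_1,x_2,y_1,y_2$; (ii) for every $x$, $f(x,\cdot)$ attains its maximum $\Phi(x):=\max_y f(x,y)$, and $\|\nabla_y f(x,y)\|^2\ge 2\mu\,[\Phi(x)-f(x,y)]$ for all $x,y$; (iii) $\Phi\ge\Phi^*$ for some real number $\Phi^*$; (iv) $G_x(x,y,\xi)$ and $G_y(x,y,\xi)$ are unbiased estimators of $\nabla_x f(x,y)$ and $\nabla_y f(x,y)$ with variances at most $\sigma^2$, where $\sigma>0$: $\mathbb{E}\|G_x(x,y,\xi)-\nabla_x f(x,y)\|^2\le\sigma^2$ and $\mathbb{E}\|G_y(x,y,\xi)-\nabla_y f(x,y)\|^2\le\sigma^2$ for all $x,y$. Fix $(x_0,y_0)$ and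 put $\kappa=l/\mu$, $\Delta=\Phi(x_0)-\Phi^*$ (assumed positive) and $a_0=\Phi(x_0)-f(x_0,y_0)$. For $T\ge1$ run Stoc-AGDA: for $t=0,\dots,T-1$ draw two fresh i.i.d. samples $\xi_1^t,\xi_2^t$ and set $x_{t+1}=x_t-\tau_1G_x(x_t,y_t,\xi^t_1)$, $y_{t+1}=y_t+\tau_2G_y(x_{t+1},y_t,\xi_2^t)$, with $$\tau_1=\min\Big\{\frac{\sqrt{\Delta}}{4\sigma\kappa^2\sqrt{Tl}},\frac1{68l\kappa^2}\Big\},\qquad \tau_2=\min\Big\{\frac{17\sqrt{\Delta}}{\sigma\sqrt{Tl}},\frac1l\Big\};$$ the output $\hat x$ is chosen uniformly at random from $x_0,\dots,x_{T-1}$. Then $\Phi$ is differentiable and $$\frac1T\sum_{t=0}^{T-1}\mathbb{E}\|\nabla\Phi(x_t)\|^2\le\frac{1088l\kappa^2}{T}\Delta+\frac{136l\kappa^2}{T}a_0+\frac{8\kappa^2\sqrt{l}\,a_0}{\sqrt{\Delta T}}\sigma+\frac{1232\kappa^2\sqrt{l\Delta}}{\sqrt T}\sigma .$$ Consequently, when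 $a_0=O(\Delta)$, Stoc-AGDA has sample complexity $O\big(\frac{l\kappa^2\Delta}{\epsilon^2}+\frac{l\kappa^4\Delta\sigma^2}{\epsilon^4}\big)$ for finding an $\epsilon$-stationary point of $\Phi$. Precisely, there is an absolute constant $C>0$ such that for all such data, all $\epsilon>0$ and all $A\ge1$ with $a_0\le A\Delta$, every run with at least one iteration that draws at least $$N=C\Big(A\,\frac{l\kappa^2\Delta}{\epsilon^2}+A^2\,\frac{l\kappa^4\Delta\sigma^2}{\epsilon^4}\Big)$$ samples in total satisfies $\mathbb{E}\|\nabla\Phi(\hat x)\|^2\le\epsilon^2$, and hence $\mathbb{E}\|\nabla\Phi(\hat x)\|\le\epsilon$; and, since each iteration draws two samples, there is such a run that draws at most $N+2$ samples. -/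

import Mathlib

open MeasureTheory ProbabilityTheory

noncomputable section

namespace NCPL

/-- `ℝᵈ` with the Euclidean norm. -/
abbrev Euc (d : ℕ) : Type := EuclideanSpace ℝ (Fin d)

variable {d₁ d₂ : ℕ}

/-- The partial gradient `∇ₓ f (x, y)`. -/
def gradX (f : Euc d₁ → Euc d₂ → ℝ) (x : Euc d₁) (y : Euc d₂) : Euc d₁ :=
  gradient (fun x' => f x' y) x

/-- The partial gradient `∇_y f (x, y)`. -/
def gradY (f : Euc d₁ → Euc d₂ → ℝ) (x : Euc d₁) (y : Euc d₂) : Euc d₂ :=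
  gradient (fun y' => f x y') y

/-- Lipschitz smoothness: `f` is (jointly) differentiable and both partial gradients are Lipschitz
with the positive constant `l`. -/
structure IsLipschitzSmooth (f : Euc d₁ → Euc d₂ → ℝ) (l : ℝ) : Prop where
  pos : 0 < l
  differentiable : Differentiable ℝ (fun p : Euc d₁ × Euc d₂ => f p.1 p.2)
  gradX_le : ∀ x₁ x₂ y₁ y₂,
    ‖gradX f x₁ y₁ - gradX f x₂ y₂‖ ≤ l * (‖x₁ - x₂‖ + ‖y₁ - y₂‖)
  gradY_le : ∀ x₁ x₂ y₁ y₂,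
    ‖gradY f x₁ y₁ - gradY f x₂ y₂‖ ≤ l * (‖x₁ - x₂‖ + ‖y₁ - y₂‖)

/-- The primal function `Φ x = max_y f (x, y)`. -/
def primal (f : Euc d₁ → Euc d₂ → ℝ) (x : Euc d₁) : ℝ := ⨆ y, f x y

/-- The Polyak-Łojasiewicz condition in `y` with constant `μ`: each `f (x, ·)` attains its maximum
(so that `primal f x` is a maximum), and `‖∇_y f (x, y)‖² ≥ 2 μ (max_y f (x, y) - f (x, y))`. -/
structure IsPL (f : Euc d₁ → Euc d₂ → ℝ) (μ : ℝ) : Prop where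
  pos : 0 < μ
  exists_max : ∀ x, ∃ y, ∀ y', f x y' ≤ f x y
  pl : ∀ x y, 2 * μ * (primal f x - f x y) ≤ ‖gradY f x y‖ ^ 2

/-- `G (x, y, ξ)`, with `ξ` of law `D`, is an unbiased estimator of `g (x, y)` with variance at
most `σ²`. -/
structure IsStochasticGradient {d : ℕ} {Ξ : Type*} [MeasurableSpace Ξ] (D : Measure Ξ)
    (G : Euc d₁ → Euc d₂ → Ξ → Euc d) (g : Euc d₁ → Euc d₂ → Euc d) (σ : ℝ) : Prop where
  measurable : Measurable (fun p : Euc d₁ × Euc d₂ × Ξ => G p.1 p.2.1 p.2.2)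
  integrable : ∀ x y, Integrable (fun s => G x y s) D
  unbiased : ∀ x y, ∫ s, G x y s ∂D = g x y
  integrable_sq : ∀ x y, Integrable (fun s => ‖G x y s - g x y‖ ^ 2) D
  variance_le : ∀ x y, ∫ s, ‖G x y s - g x y‖ ^ 2 ∂D ≤ σ ^ 2

/-- The random variables `ξ t i` (`t ∈ ℕ`, `i ∈ {0, 1}`) are independent with common law `D`. -/
structure IsIID {Ω Ξ : Type*} [MeasurableSpace Ω] [MeasurableSpace Ξ] (P : Measure Ω)
    (D : Measure Ξ) (ξ : ℕ → Fin 2 → Ω → Ξ) : Prop where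
  measurable : ∀ t i, Measurable (ξ t i)
  law : ∀ t i, P.map (ξ t i) = D
  indep : iIndepFun (fun p : ℕ × Fin 2 => ξ p.1 p.2) P

/-- A state of the algorithm: the two iterates and the number of samples drawn so far. -/
structure State (d₁ d₂ : ℕ) where
  x : Euc d₁
  y : Euc d₂
  samples : ℕ

/-- The state of Stoc-AGDA after `t` iterations, run with step sizes `τ₁`, `τ₂` from `(x₀, y₀)`,
when the two samples drawn in iteration `t` are `s t 0` and `s t 1`. -/
def stocAGDA {Ξ : Type*} (Gx : Euc d₁ → Euc d₂ → Ξ → Euc d₁) (Gy : Euc d₁ → Euc d₂ → Ξ → Euc d₂)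
    (τ₁ τ₂ : ℝ) (x₀ : Euc d₁) (y₀ : Euc d₂) (s : ℕ → Fin 2 → Ξ) : ℕ → State d₁ d₂
  | 0 => ⟨x₀, y₀, 0⟩
  | t + 1 =>
    let S := stocAGDA Gx Gy τ₁ τ₂ x₀ y₀ s t
    let x' := S.x - τ₁ • Gx S.x S.y (s t 0)
    ⟨x', S.y + τ₂ • Gy x' S.y (s t 1), S.samples + 2⟩

/-- The step size for `x` in a run of `T` iterations. -/
def stepX (l κ σ Δ : ℝ) (T : ℕ) : ℝ :=
  min (√Δ / (4 * σ * κ ^ 2 * √(T * l))) (1 / (68 * l * κ ^ 2))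

/-- The step size for `y` in a run of `T` iterations. -/
def stepY (l σ Δ : ℝ) (T : ℕ) : ℝ :=
  min (17 * √Δ / (σ * √(T * l))) (1 / l)

/-- The law of a uniform random index in `{0, …, T - 1}`, drawn independently of `P`, joined to
`P`: the probability space on which the output of a run of `T` iterations lives. -/
def outputMeasure {Ω : Type*} [MeasurableSpace Ω] (P : Measure Ω) (T : ℕ) : Measure (Ω × Fin T) :=
  P.prod (uniformOn Set.univ)

/-- The random point `X` is an `ε`-stationary point of `Φ` in expectation, in mean square (and in
mean). -/
structure IsStationaryInExpectation {Ω : Type*} [MeasurableSpace Ω] (Q : Measure Ω)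
    (Φ : Euc d₁ → ℝ) (X : Ω → Euc d₁) (ε : ℝ) : Prop where
  integrable_sq : Integrable (fun ω => ‖gradient Φ (X ω)‖ ^ 2) Q
  sq_le : ∫ ω, ‖gradient Φ (X ω)‖ ^ 2 ∂Q ≤ ε ^ 2
  integrable : Integrable (fun ω => ‖gradient Φ (X ω)‖) Q
  le : ∫ ω, ‖gradient Φ (X ω)‖ ∂Q ≤ ε

end NCPL

end

open NCPL

/-! The proof follows a potential. By the PL condition in `y`, the primal function `Φ = primal f` is
differentiable with `∇ Φ x = ∇ₓ f (x, z)` for every maximiser `z` of `f (x, ·)`, and it is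
smooth with constant `2 l κ` (`abs_primal_sub_le`): the lower quadratic bound is the one for
`f (·, z)`, and the upper one follows from the PL inequality at `(x + v, z)`. The PL condition also
implies an error bound (`exists_isMax_near_of_pl`), so `‖∇ₓ f (x, y) - ∇ Φ x‖²` is at most a
multiple of the gap `Φ x - f (x, y)` (`norm_gradX_sub_gradient_primal_sq_le`).

Since the step sizes satisfy `τ₂ = 68 κ² τ₁`, the ascent step in `y` shrinks the gap by more
than this bias costs, and the potential `Φ x - Φ* + (Φ x - f (x, y)) / 8` decreases in
expectation by `τ₁ / 2 ‖∇ Φ x‖²` in each iteration, up to a noise term `291 l κ⁴ τ₁² σ²`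
(`lintegral_potential_step_le`). The fresh samples are independent of the current iterates, so
this holds along the run (`IsIID.lintegral_fresh`), and summing over the iterations gives the
rate. The potential is nonnegative, so expectations are taken in `ℝ≥0∞`, with `∫⁻`; no
moment bound on the iterates is needed, and the integrability of `‖∇ Φ (x_t)‖²` is a consequence
of the estimate. The sample complexity follows by comparing each part of the rate with `ε² / 2`. -/

namespace NCPL

open scoped RealInnerProductSpace ENNReal
open Filter

/-! ### Quadratic bounds and error bounds for smooth functions -/

section Smooth

variable {E : Type*} [NormedAddCommGroup E] [InnerProductSpace ℝ E] [CompleteSpace E]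

theorem hasDerivAt_comp_line {g : E → ℝ} (hg : Differentiable ℝ g) (x v : E) (t : ℝ) :
    HasDerivAt (fun s : ℝ => g (x + s • v)) ⟪gradient g (x + t • v), v⟫ t := by
  have h1 := (hg (x + t • v)).hasGradientAt.hasFDerivAt
  have h2 : HasDerivAt (fun s : ℝ => x + s • v) v t := by
    simpa using ((hasDerivAt_id t).smul_const v).const_add x
  have h3 := h1.comp_hasDerivAt t h2
  rwa [InnerProductSpace.toDual_apply_apply] at h3

theorem le_quadratic_of_gradient_lipschitz {g : E → ℝ} {l : ℝ} (hg : Differentiable ℝ g)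
    (hl : ∀ x y, ‖gradient g x - gradient g y‖ ≤ l * ‖x - y‖) (x v : E) :
    g (x + v) ≤ g x + ⟪gradient g x, v⟫ + l / 2 * ‖v‖ ^ 2 := by
  have hB : ∀ t : ℝ, HasDerivAt
      (fun s : ℝ => g x + s * ⟪gradient g x, v⟫ + l / 2 * ‖v‖ ^ 2 * s ^ 2)
      (⟪gradient g x, v⟫ + l * t * ‖v‖ ^ 2) t := by
    intro t
    have := (((hasDerivAt_id t).mul_const ⟪gradient g x, v⟫).const_add (g x)).add
      (((hasDerivAt_id t).pow 2).const_mul (l / 2 * ‖v‖ ^ 2))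
    refine this.congr_deriv ?_
    simp only [id]
    ring
  have key := image_le_of_deriv_right_le_deriv_boundary (a := 0) (b := 1)
    (f := fun s : ℝ => g (x + s • v)) (f' := fun t => ⟪gradient g (x + t • v), v⟫)
    (fun t _ => (hasDerivAt_comp_line hg x v t).continuousAt.continuousWithinAt)
    (fun t _ => (hasDerivAt_comp_line hg x v t).hasDerivWithinAt)
    (by simp) (fun t _ => (hB t).continuousAt.continuousWithinAt)
    (fun t _ => (hB t).hasDerivWithinAt) ?_ (x := 1) ⟨zero_le_one, le_rfl⟩
  · simpa using key
  · rintro t ⟨ht, -⟩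
    have h1 : ⟪gradient g (x + t • v) - gradient g x, v⟫ ≤ l * (t * ‖v‖) * ‖v‖ := by
      refine (real_inner_le_norm _ _).trans (mul_le_mul_of_nonneg_right ?_ (norm_nonneg v))
      simpa [norm_smul, abs_of_nonneg ht] using hl (x + t • v) x
    rw [inner_sub_left] at h1
    nlinarith

theorem quadratic_le_of_gradient_lipschitz {g : E → ℝ} {l : ℝ} (hg : Differentiable ℝ g)
    (hl : ∀ x y, ‖gradient g x - gradient g y‖ ≤ l * ‖x - y‖) (x v : E) :
    g x + ⟪gradient g x, v⟫ - l / 2 * ‖v‖ ^ 2 ≤ g (x + v) := by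
  have hgr : ∀ z, gradient (fun w => -g w) z = -gradient g z := fun z => by
    refine HasGradientAt.gradient ?_
    rw [hasGradientAt_iff_hasFDerivAt, map_neg]
    exact (hg z).hasGradientAt.hasFDerivAt.neg
  have h := le_quadratic_of_gradient_lipschitz (g := fun w => -g w) (l := l) hg.neg
    (fun a b => by
      rw [hgr, hgr, ← norm_neg]
      simpa [sub_eq_add_neg, add_comm] using hl a b) x v
  rw [hgr, inner_neg_left] at h
  linarith

/-- Error bound under the Polyak-Łojasiewicz condition, with a constant that is twice the optimal
one. The maximiser is produced by Ekeland's argument: `√(M - h) + (√μ / 2) ‖· - y‖` has a minimiser,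
and there `h` equals its maximum `M`, since elsewhere `√(M - h)` has slope at least `√(μ / 2)`. -/
theorem exists_isMax_near_of_pl [ProperSpace E] {h : E → ℝ} {μ M : ℝ} (hμ : 0 < μ)
    (hd : Differentiable ℝ h) (hM : ∀ z, h z ≤ M)
    (hpl : ∀ z, 2 * μ * (M - h z) ≤ ‖gradient h z‖ ^ 2) (y : E) :
    ∃ z, h z = M ∧ μ * ‖y - z‖ ^ 2 ≤ 4 * (M - h y) := by
  set c : ℝ := √μ / 2 with hc
  have hc0 : 0 < c := by positivity
  have hc2 : 4 * c ^ 2 = μ := by rw [hc, div_pow, Real.sq_sqrt hμ.le]; ring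
  have hcont : Continuous fun z => √(M - h z) + c * ‖z - y‖ :=
    ((continuous_const.sub hd.continuous).sqrt).add
      (continuous_const.mul (continuous_id.sub continuous_const).norm)
  have hlim : Tendsto (fun z => √(M - h z) + c * ‖z - y‖) (cocompact E) atTop := by
    refine tendsto_atTop_mono (f := fun z => c * (‖z‖ - ‖y‖)) (fun z => ?_) ?_
    · nlinarith [Real.sqrt_nonneg (M - h z), norm_sub_norm_le z y]
    · exact (tendsto_atTop_add_const_right _ (-‖y‖)
        (tendsto_norm_cocompact_atTop (E := E))).const_mul_atTop hc0
  obtain ⟨z, hz⟩ := hcont.exists_forall_le hlim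
  have hzy := hz y
  simp only [sub_self, norm_zero, mul_zero, add_zero] at hzy
  rcases (hM z).lt_or_eq with hlt | heq
  · exfalso
    set v := gradient h z with hv
    have hr : 0 < M - h z := sub_pos.2 hlt
    have hr' : 0 < √(M - h z) := Real.sqrt_pos.2 hr
    have hline := hasDerivAt_comp_line hd z v 0
    have hz0 : z + (0 : ℝ) • v = z := by simp
    have hder : HasDerivAt (fun s : ℝ => √(M - h (z + s • v)) + c * s * ‖v‖)
        (-⟪v, v⟫ / (2 * √(M - h z)) + c * ‖v‖) 0 := by
      have h1 := (hline.const_sub M).sqrt (by rw [hz0]; exact hr.ne')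
      rw [hz0] at h1
      refine h1.add ?_
      simpa using ((hasDerivAt_id (0 : ℝ)).const_mul c).mul_const ‖v‖
    have hnn : 0 ≤ -⟪v, v⟫ / (2 * √(M - h z)) + c * ‖v‖ := by
      refine ge_of_tendsto (hder.tendsto_slope.mono_left
        (nhdsWithin_mono 0 (fun t (ht : t ∈ Set.Ioi (0 : ℝ)) => ne_of_gt ht))) ?_
      filter_upwards [self_mem_nhdsWithin] with t (ht : 0 < t)
      rw [slope_def_field]
      refine div_nonneg ?_ (by linarith)
      have h3 := hz (z + t • v)
      have h4 : ‖z + t • v - y‖ ≤ ‖z - y‖ + t * ‖v‖ := by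
        rw [show z + t • v - y = (z - y) + t • v by abel]
        refine (norm_add_le _ _).trans ?_
        rw [norm_smul, Real.norm_of_nonneg ht.le]
      simp only [hz0]
      nlinarith
    rw [real_inner_self_eq_norm_sq] at hnn
    have hp := hpl z
    rw [← hv] at hp
    have hsq := Real.sq_sqrt hr.le
    have hvpos : 0 < ‖v‖ := by
      have : 0 < ‖v‖ ^ 2 := lt_of_lt_of_le (by positivity) hp
      exact (sq_pos_iff.1 this).lt_of_le' (norm_nonneg v)
    have h5 : ‖v‖ ≤ 2 * c * √(M - h z) := by
      rw [neg_div, neg_add_eq_sub, sub_nonneg, div_le_iff₀ (by positivity)] at hnn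
      nlinarith
    have h6 : ‖v‖ ^ 2 ≤ (2 * c * √(M - h z)) ^ 2 := by gcongr
    nlinarith [mul_pos hμ hr]
  · refine ⟨z, heq, ?_⟩
    rw [heq, sub_self, Real.sqrt_zero, zero_add] at hzy
    have h1 : (c * ‖z - y‖) ^ 2 ≤ √(M - h y) ^ 2 := by gcongr
    rw [Real.sq_sqrt (sub_nonneg.2 (hM y)), mul_pow] at h1
    rw [norm_sub_rev]
    nlinarith

theorem hasGradientAt_of_quadratic_bound {g : E → ℝ} {a x : E} {K : ℝ}
    (h : ∀ v : E, |g (x + v) - g x - ⟪a, v⟫| ≤ K * ‖v‖ ^ 2) : HasGradientAt g a x := by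
  have h0 : HasFDerivAt (fun z : E => g z - g x - ⟪a, z - x⟫) (0 : E →L[ℝ] ℝ) x := by
    refine Asymptotics.IsBigO.hasFDerivAt (n := 2) ?_ one_lt_two
    refine Asymptotics.IsBigO.of_bound K (Eventually.of_forall fun z => ?_)
    have := h (z - x)
    rw [add_sub_cancel] at this
    simpa using this
  have h1 : HasFDerivAt (fun z : E => g x + ⟪a, z - x⟫) (InnerProductSpace.toDual ℝ E a) x := by
    have := ((InnerProductSpace.toDual ℝ E a).hasFDerivAt.comp x
      ((hasFDerivAt_id x).sub_const x)).const_add (g x)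
    simpa using this
  rw [hasGradientAt_iff_hasFDerivAt]
  have h2 := h0.add h1
  rw [zero_add] at h2
  refine h2.congr_of_eventuallyEq (Eventually.of_forall fun z => ?_)
  simp only [Pi.add_apply]
  ring

end Smooth

/-! ### The primal function -/

section Primal

variable {d₁ d₂ : ℕ} {f : Euc d₁ → Euc d₂ → ℝ} {l μ : ℝ}

theorem IsLipschitzSmooth.differentiable_left (hf : IsLipschitzSmooth f l) (y : Euc d₂) :
    Differentiable ℝ fun x => f x y :=
  hf.differentiable.comp (differentiable_id.prodMk (differentiable_const y))

theorem IsLipschitzSmooth.differentiable_right (hf : IsLipschitzSmooth f l) (x : Euc d₁) :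
    Differentiable ℝ (f x) :=
  hf.differentiable.comp ((differentiable_const x).prodMk differentiable_id)

theorem IsLipschitzSmooth.le_left (hf : IsLipschitzSmooth f l) (x v : Euc d₁) (y : Euc d₂) :
    f (x + v) y ≤ f x y + ⟪gradX f x y, v⟫ + l / 2 * ‖v‖ ^ 2 :=
  le_quadratic_of_gradient_lipschitz (hf.differentiable_left y)
    (fun a b => by simpa [gradX] using hf.gradX_le a b y y) x v

theorem IsLipschitzSmooth.ge_left (hf : IsLipschitzSmooth f l) (x v : Euc d₁) (y : Euc d₂) :
    f x y + ⟪gradX f x y, v⟫ - l / 2 * ‖v‖ ^ 2 ≤ f (x + v) y :=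
  quadratic_le_of_gradient_lipschitz (hf.differentiable_left y)
    (fun a b => by simpa [gradX] using hf.gradX_le a b y y) x v

theorem IsLipschitzSmooth.ge_right (hf : IsLipschitzSmooth f l) (x : Euc d₁) (y v : Euc d₂) :
    f x y + ⟪gradY f x y, v⟫ - l / 2 * ‖v‖ ^ 2 ≤ f x (y + v) :=
  quadratic_le_of_gradient_lipschitz (hf.differentiable_right x)
    (fun a b => by simpa [gradY] using hf.gradY_le x x a b) y v

theorem IsPL.le_primal (hp : IsPL f μ) (x : Euc d₁) (y : Euc d₂) : f x y ≤ primal f x := by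
  obtain ⟨y₁, h⟩ := hp.exists_max x
  exact le_ciSup (f := fun y => f x y) ⟨f x y₁, by rintro _ ⟨z, rfl⟩; exact h z⟩ y

theorem IsPL.exists_eq_primal (hf : IsLipschitzSmooth f l) (hp : IsPL f μ) (x : Euc d₁)
    (y : Euc d₂) : ∃ z, f x z = primal f x ∧ μ * ‖y - z‖ ^ 2 ≤ 4 * (primal f x - f x y) :=
  exists_isMax_near_of_pl hp.pos (hf.differentiable_right x) (hp.le_primal x) (hp.pl x) y

theorem gradY_eq_zero_of_eq_primal (hp : IsPL f μ) {x : Euc d₁} {z : Euc d₂}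
    (hz : f x z = primal f x) : gradY f x z = 0 := by
  have hmax : IsLocalMax (f x) z :=
    Eventually.of_forall fun w => (hp.le_primal x w).trans hz.ge
  simp [gradY, gradient, hmax.fderiv_eq_zero]

/-- The upper bound comes from the PL inequality at `(x + v, z)`, where the gradient in `y` has norm
at most `l ‖v‖` because it vanishes at `(x, z)`. -/
theorem abs_primal_sub_le (hf : IsLipschitzSmooth f l) (hp : IsPL f μ) (hμl : μ ≤ l)
    {x : Euc d₁} {z : Euc d₂} (hz : f x z = primal f x) (v : Euc d₁) :
    |primal f (x + v) - primal f x - ⟪gradX f x z, v⟫| ≤ l * (l / μ) * ‖v‖ ^ 2 := by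
  have hμ := hp.pos
  have hl := hf.pos
  have hκ : 1 ≤ l / μ := (one_le_div hμ).2 hμl
  have h1 := hf.ge_left x v z
  have h2 := hf.le_left x v z
  have h3 := hp.le_primal (x + v) z
  have h4 : ‖gradY f (x + v) z‖ ≤ l * ‖v‖ := by
    simpa [gradY_eq_zero_of_eq_primal hp hz] using hf.gradY_le (x + v) x z z
  have h5 : 2 * μ * (primal f (x + v) - f (x + v) z) ≤ (l * ‖v‖) ^ 2 :=
    (hp.pl (x + v) z).trans (by gcongr)
  have h6 : primal f (x + v) - f (x + v) z ≤ l * (l / μ) / 2 * ‖v‖ ^ 2 := by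
    rw [show l * (l / μ) / 2 * ‖v‖ ^ 2 = (l * ‖v‖) ^ 2 / (2 * μ) by field_simp,
      le_div_iff₀ (by positivity)]
    linarith
  have h7 : l * ‖v‖ ^ 2 ≤ l * (l / μ) * ‖v‖ ^ 2 := by
    gcongr
    nlinarith
  rw [abs_le]
  constructor <;> nlinarith [sq_nonneg ‖v‖]

theorem hasGradientAt_primal (hf : IsLipschitzSmooth f l) (hp : IsPL f μ) (hμl : μ ≤ l)
    {x : Euc d₁} {z : Euc d₂} (hz : f x z = primal f x) :
    HasGradientAt (primal f) (gradX f x z) x :=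
  hasGradientAt_of_quadratic_bound (abs_primal_sub_le hf hp hμl hz)

theorem differentiable_primal (hf : IsLipschitzSmooth f l) (hp : IsPL f μ) (hμl : μ ≤ l) :
    Differentiable ℝ (primal f) := fun x => by
  obtain ⟨z, hz, -⟩ := hp.exists_eq_primal hf x 0
  exact (hasGradientAt_primal hf hp hμl hz).differentiableAt

theorem primal_add_le (hf : IsLipschitzSmooth f l) (hp : IsPL f μ) (hμl : μ ≤ l)
    (x v : Euc d₁) :
    primal f (x + v) ≤ primal f x + ⟪gradient (primal f) x, v⟫ + l * (l / μ) * ‖v‖ ^ 2 := by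
  obtain ⟨z, hz, -⟩ := hp.exists_eq_primal hf x 0
  rw [(hasGradientAt_primal hf hp hμl hz).gradient]
  linarith [(abs_le.1 (abs_primal_sub_le hf hp hμl hz v)).2]

/-- The bias of `∇ₓ f (x, y)` as an estimate of `∇ Φ x` is controlled by the gap in `y`. -/
theorem norm_gradX_sub_gradient_primal_sq_le (hf : IsLipschitzSmooth f l) (hp : IsPL f μ)
    (hμl : μ ≤ l) (x : Euc d₁) (y : Euc d₂) :
    ‖gradX f x y - gradient (primal f) x‖ ^ 2 ≤ 4 * l * (l / μ) * (primal f x - f x y) := by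
  have hμ := hp.pos
  have hl := hf.pos
  obtain ⟨z, hz, hyz⟩ := hp.exists_eq_primal hf x y
  rw [(hasGradientAt_primal hf hp hμl hz).gradient]
  have h1 : ‖gradX f x y - gradX f x z‖ ≤ l * ‖y - z‖ := by simpa using hf.gradX_le x x y z
  calc ‖gradX f x y - gradX f x z‖ ^ 2 ≤ (l * ‖y - z‖) ^ 2 := by gcongr
    _ = l ^ 2 / μ * (μ * ‖y - z‖ ^ 2) := by field_simp
    _ ≤ l ^ 2 / μ * (4 * (primal f x - f x y)) := by gcongr
    _ = 4 * l * (l / μ) * (primal f x - f x y) := by field_simp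

theorem measurable_gradient_primal (f : Euc d₁ → Euc d₂ → ℝ) :
    Measurable fun x => gradient (primal f) x :=
  (InnerProductSpace.toDual ℝ (Euc d₁)).symm.continuous.measurable.comp
    (measurable_fderiv ℝ (primal f))

end Primal

/-! ### One iteration in expectation -/

section Step

variable {d₁ d₂ : ℕ} {Ξ : Type*} [MeasurableSpace Ξ] {D : Measure Ξ} [IsProbabilityMeasure D]
  {f : Euc d₁ → Euc d₂ → ℝ} {l μ σ : ℝ}

/-- Expectation of a nonnegative quantity with a quadratic upper bound in a stochastic gradient. The
nonnegativity of the bound allows it to be moved across inequalities in `ℝ≥0∞`. -/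
theorem IsStochasticGradient.lintegral_ofReal_le {d : ℕ} {G : Euc d₁ → Euc d₂ → Ξ → Euc d}
    {g : Euc d₁ → Euc d₂ → Euc d} (hG : IsStochasticGradient D G g σ) (x : Euc d₁) (y : Euc d₂)
    {F : Ξ → ℝ} {A B : ℝ} {b : Euc d} (hB : 0 ≤ B) (hF0 : ∀ s, 0 ≤ F s)
    (hF : ∀ s, F s ≤ A + ⟪b, G x y s⟫ + B * ‖G x y s‖ ^ 2) :
    0 ≤ A + ⟪b, g x y⟫ + B * (‖g x y‖ ^ 2 + σ ^ 2) ∧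
      ∫⁻ s, ENNReal.ofReal (F s) ∂D ≤
        ENNReal.ofReal (A + ⟪b, g x y⟫ + B * (‖g x y‖ ^ 2 + σ ^ 2)) := by
  have hint := hG.integrable x y
  have hsq := hG.integrable_sq x y
  have hrw : ∀ s, A + ⟪b, G x y s⟫ + B * ‖G x y s‖ ^ 2 =
      (A - B * ‖g x y‖ ^ 2) + ⟪b + (2 * B) • g x y, G x y s⟫ + B * ‖G x y s - g x y‖ ^ 2 := by
    intro s
    rw [norm_sub_sq_real, inner_add_left, real_inner_smul_left, real_inner_comm (g x y)]
    ring
  have hi1 : Integrable (fun s => ⟪b + (2 * B) • g x y, G x y s⟫) D := hint.const_inner _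
  have hi2 : Integrable (fun s => A - B * ‖g x y‖ ^ 2 + ⟪b + (2 * B) • g x y, G x y s⟫) D :=
    (integrable_const _).add hi1
  have hiQ : Integrable (fun s => A + ⟪b, G x y s⟫ + B * ‖G x y s‖ ^ 2) D := by
    simp_rw [hrw]
    exact hi2.add (hsq.const_mul B)
  have hQ : ∫ s, (A + ⟪b, G x y s⟫ + B * ‖G x y s‖ ^ 2) ∂D ≤
      A + ⟪b, g x y⟫ + B * (‖g x y‖ ^ 2 + σ ^ 2) := by
    simp_rw [hrw]
    rw [integral_add hi2 (hsq.const_mul B), integral_add (integrable_const _) hi1,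
      integral_inner hint, hG.unbiased, integral_const_mul, integral_const, inner_add_left,
      real_inner_smul_left, real_inner_self_eq_norm_sq]
    simp only [probReal_univ, one_smul]
    nlinarith [mul_le_mul_of_nonneg_left (hG.variance_le x y) hB]
  have hQ0 : ∀ s, 0 ≤ A + ⟪b, G x y s⟫ + B * ‖G x y s‖ ^ 2 := fun s => (hF0 s).trans (hF s)
  refine ⟨(integral_nonneg hQ0).trans hQ, ?_⟩
  calc ∫⁻ s, ENNReal.ofReal (F s) ∂D
      ≤ ∫⁻ s, ENNReal.ofReal (A + ⟪b, G x y s⟫ + B * ‖G x y s‖ ^ 2) ∂D :=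
        lintegral_mono fun s => ENNReal.ofReal_le_ofReal (hF s)
    _ = ENNReal.ofReal (∫ s, (A + ⟪b, G x y s⟫ + B * ‖G x y s‖ ^ 2) ∂D) :=
        (ofReal_integral_eq_lintegral_ofReal hiQ (Eventually.of_forall hQ0)).symm
    _ ≤ _ := ENNReal.ofReal_le_ofReal hQ

/-- The potential that decreases along the iterations: the primal gap plus an eighth of the gap
in `y`. -/
noncomputable def potential (f : Euc d₁ → Euc d₂ → ℝ) (Φstar : ℝ) (x : Euc d₁) (y : Euc d₂) : ℝ :=
  primal f x - Φstar + (primal f x - f x y) / 8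

theorem potential_nonneg (hp : IsPL f μ) {Φstar : ℝ} (hΦ : ∀ x, Φstar ≤ primal f x) (x : Euc d₁)
    (y : Euc d₂) : 0 ≤ potential f Φstar x y := by
  have h1 := hp.le_primal x y
  have h2 := hΦ x
  unfold potential
  linarith

theorem lintegral_potential_ascent_le (hf : IsLipschitzSmooth f l) (hp : IsPL f μ)
    {Gy : Euc d₁ → Euc d₂ → Ξ → Euc d₂} (hGy : IsStochasticGradient D Gy (gradY f) σ)
    {Φstar τ₂ : ℝ} (hΦ : ∀ x, Φstar ≤ primal f x) (hτ : 0 ≤ τ₂) (hτl : l * τ₂ ≤ 1)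
    (x : Euc d₁) (y : Euc d₂) :
    ∫⁻ s, ENNReal.ofReal (potential f Φstar x (y + τ₂ • Gy x y s)) ∂D ≤
      ENNReal.ofReal (primal f x - Φstar +
        ((1 - μ * τ₂) * (primal f x - f x y) + l / 2 * τ₂ ^ 2 * σ ^ 2) / 8) := by
  have hl := hf.pos
  refine (hGy.lintegral_ofReal_le x y (A := potential f Φstar x y) (B := l / 16 * τ₂ ^ 2)
    (b := (-(τ₂ / 8)) • gradY f x y) (by positivity)
    (fun s => potential_nonneg hp hΦ _ _) (fun s => ?_)).2.trans (ENNReal.ofReal_le_ofReal ?_)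
  · have h1 := hf.ge_right x y (τ₂ • Gy x y s)
    rw [real_inner_smul_right, norm_smul, mul_pow, Real.norm_eq_abs, sq_abs] at h1
    rw [real_inner_smul_left]
    unfold potential
    linarith
  · have h1 := hp.pl x y
    have h2 : 0 ≤ τ₂ * (1 - l * τ₂) * ‖gradY f x y‖ ^ 2 := by
      have := sub_nonneg.2 hτl
      positivity
    have h3 := mul_le_mul_of_nonneg_left h1 hτ
    rw [real_inner_smul_left, real_inner_self_eq_norm_sq]
    unfold potential
    nlinarith

/-- The arithmetic of one iteration: `p2`, `q2` and `ip` stand for the squared norms and the inner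
product of `∇ Φ x` and `∇ₓ f (x, y)`, and `s2` for the variance. -/
theorem step_arithmetic {l κ τ p2 q2 ip gap s2 : ℝ} (hl : 0 < l) (hκ : 1 ≤ κ) (hτ : 0 < τ)
    (hlτ : 68 * (l * κ ^ 2 * τ) ≤ 1) (hp2 : 0 ≤ p2) (hq2 : 0 ≤ q2) (hgap : 0 ≤ gap)
    (hs2 : 0 ≤ s2) {β : ℝ} (hβ : β = (1 - 68 * (l * κ * τ)) / 8)
    (hbias : q2 - 2 * ip + p2 ≤ 4 * l * κ * gap) :
    -(68 * (l * κ * τ) / 8 * gap) + l / 2 * (68 * κ ^ 2 * τ) ^ 2 * s2 / 8 +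
      τ * (β * q2 - (1 + β) * ip) +
      ((1 + β) * (l * κ) + β * (l / 2)) * τ ^ 2 * (q2 + s2) + τ / 2 * p2 ≤
      291 * l * κ ^ 4 * τ ^ 2 * s2 := by
  have hκ0 : 0 < κ := by linarith
  have hlκ0 : 0 < l * κ * τ := by positivity
  have hlκ : l * κ * τ ≤ l * κ ^ 2 * τ := by
    gcongr
    nlinarith
  have hβ0 : 0 ≤ β := by rw [hβ]; linarith
  have hβ1 : β ≤ 1 / 8 := by rw [hβ]; linarith
  -- noise, with `κ ≥ 1` absorbing the lower powers of `κ`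
  have hnoise : l / 2 * (68 * κ ^ 2 * τ) ^ 2 * s2 / 8 +
      ((1 + β) * (l * κ) + β * (l / 2)) * τ ^ 2 * s2 ≤ 291 * l * κ ^ 4 * τ ^ 2 * s2 := by
    have hκ14 : κ ≤ κ ^ 4 := le_self_pow₀ hκ (by norm_num)
    have h1 : (1 + β) * κ + β / 2 ≤ 2 * κ ^ 4 := by nlinarith
    have h2 : 0 ≤ l * τ ^ 2 * s2 := by positivity
    linarith [mul_le_mul_of_nonneg_right h1 h2]
  -- the coefficient of `q2` is nonpositive
  have hq : (-(1 + β) / 2 + β + ((1 + β) * (l * κ * τ) + β * (l * τ / 2))) * (τ * q2) ≤ 0 := by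
    refine mul_nonpos_of_nonpos_of_nonneg ?_ (by positivity)
    have h1 : l * τ ≤ l * κ * τ := by nlinarith [mul_pos hl hτ]
    have h2 : 0 ≤ l * τ := by positivity
    nlinarith
  have hpn : 0 ≤ β * (τ * p2) := by positivity
  -- the bias is paid for by the decrease of the gap
  have hb := mul_le_mul_of_nonneg_left hbias (by positivity : 0 ≤ (1 + β) * τ / 2)
  have hg : (1 + β) * τ / 2 * (4 * l * κ * gap) ≤ 68 * (l * κ * τ) / 8 * gap := by
    have : 0 ≤ l * κ * τ * gap := by positivity
    nlinarith
  linarith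

/-- Expected decrease of the potential in one iteration. The ratio `68 κ²` of the step sizes makes
the decrease of the gap in `y` outweigh the bias of `∇ₓ f (x, y)` as an estimate of `∇ Φ x`. -/
theorem lintegral_potential_step_le (hf : IsLipschitzSmooth f l) (hp : IsPL f μ) (hμl : μ ≤ l)
    {Gx : Euc d₁ → Euc d₂ → Ξ → Euc d₁} (hGx : IsStochasticGradient D Gx (gradX f) σ)
    {Gy : Euc d₁ → Euc d₂ → Ξ → Euc d₂} (hGy : IsStochasticGradient D Gy (gradY f) σ)
    {Φstar κ τ₁ τ₂ : ℝ} (hΦ : ∀ x, Φstar ≤ primal f x) (hκ : κ = l / μ) (hτ₁ : 0 < τ₁)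
    (hτ₁l : 68 * (l * κ ^ 2 * τ₁) ≤ 1) (hτ₂ : τ₂ = 68 * κ ^ 2 * τ₁)
    (x : Euc d₁) (y : Euc d₂) :
    (∫⁻ s₀, ∫⁻ s₁, ENNReal.ofReal (potential f Φstar (x - τ₁ • Gx x y s₀)
        (y + τ₂ • Gy (x - τ₁ • Gx x y s₀) y s₁)) ∂D ∂D) +
        ENNReal.ofReal (τ₁ / 2 * ‖gradient (primal f) x‖ ^ 2) ≤
      ENNReal.ofReal (potential f Φstar x y) +
        ENNReal.ofReal (291 * l * κ ^ 4 * τ₁ ^ 2 * σ ^ 2) := by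
  have hl := hf.pos
  have hμ := hp.pos
  have hκ1 : 1 ≤ κ := by rw [hκ]; exact (one_le_div hμ).2 hμl
  have hκ0 : 0 < κ := by linarith
  have hτ₂0 : 0 ≤ τ₂ := by rw [hτ₂]; positivity
  have hlτ₂ : l * τ₂ ≤ 1 := by rw [hτ₂]; linarith
  have hμτ₂ : μ * τ₂ = 68 * (l * κ * τ₁) := by rw [hτ₂, hκ]; field_simp
  have hμτ₂1 : μ * τ₂ ≤ 1 := (mul_le_mul_of_nonneg_right hμl hτ₂0).trans hlτ₂
  set β : ℝ := (1 - μ * τ₂) / 8 with hβ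
  have hβ0 : 0 ≤ β := by rw [hβ]; linarith
  have hβ1 : β ≤ 1 / 8 := by
    have : 0 ≤ μ * τ₂ := by positivity
    rw [hβ]; linarith
  set n : ℝ := l / 2 * τ₂ ^ 2 * σ ^ 2 / 8 with hn
  have hn0 : 0 ≤ n := by rw [hn]; positivity
  have hinner : ∀ s₀, ∫⁻ s₁, ENNReal.ofReal (potential f Φstar (x - τ₁ • Gx x y s₀)
      (y + τ₂ • Gy (x - τ₁ • Gx x y s₀) y s₁)) ∂D ≤
      ENNReal.ofReal (primal f (x - τ₁ • Gx x y s₀) - Φstar +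
        β * (primal f (x - τ₁ • Gx x y s₀) - f (x - τ₁ • Gx x y s₀) y) + n) := fun s₀ => by
    refine (lintegral_potential_ascent_le hf hp hGy hΦ hτ₂0 hlτ₂ _ y).trans
      (ENNReal.ofReal_le_ofReal (le_of_eq ?_))
    rw [hβ, hn]
    ring
  obtain ⟨hR0, hR⟩ := hGx.lintegral_ofReal_le x y
    (F := fun s => primal f (x - τ₁ • Gx x y s) - Φstar +
        β * (primal f (x - τ₁ • Gx x y s) - f (x - τ₁ • Gx x y s) y) + n)
    (A := (1 + β) * primal f x - Φstar - β * f x y + n)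
    (B := ((1 + β) * (l * κ) + β * (l / 2)) * τ₁ ^ 2)
    (b := τ₁ • (β • gradX f x y - (1 + β) • gradient (primal f) x)) (by positivity)
    (fun s => by
      have h1 := hΦ (x - τ₁ • Gx x y s)
      have h2 := mul_nonneg hβ0 (sub_nonneg.2 (hp.le_primal (x - τ₁ • Gx x y s) y))
      linarith)
    (fun s => by
      have h1 := primal_add_le hf hp hμl x (-(τ₁ • Gx x y s))
      have h2 := hf.ge_left x (-(τ₁ • Gx x y s)) y
      rw [← sub_eq_add_neg, norm_neg, norm_smul, mul_pow, Real.norm_eq_abs, sq_abs,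
        inner_neg_right, real_inner_smul_right] at h1 h2
      rw [← hκ] at h1
      have h3 := mul_le_mul_of_nonneg_left h1 (by linarith : 0 ≤ 1 + β)
      have h4 := mul_le_mul_of_nonneg_left h2 hβ0
      rw [real_inner_smul_left, inner_sub_left, real_inner_smul_left, real_inner_smul_left]
      linarith)
  set p := gradient (primal f) x with hpdef
  set q := gradX f x y with hqdef
  rw [real_inner_smul_left, inner_sub_left, real_inner_smul_left, real_inner_smul_left,
    real_inner_self_eq_norm_sq] at hR0 hR
  have hbias := norm_gradX_sub_gradient_primal_sq_le hf hp hμl x y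
  rw [← hpdef, ← hqdef, ← hκ, norm_sub_sq_real, real_inner_comm] at hbias
  set gap := primal f x - f x y with hgap
  have hgap0 : 0 ≤ gap := sub_nonneg.2 (hp.le_primal x y)
  have hbound : ((1 + β) * primal f x - Φstar - β * f x y + n +
      τ₁ * (β * ‖q‖ ^ 2 - (1 + β) * ⟪p, q⟫) +
      ((1 + β) * (l * κ) + β * (l / 2)) * τ₁ ^ 2 * (‖q‖ ^ 2 + σ ^ 2)) + τ₁ / 2 * ‖p‖ ^ 2 ≤
      potential f Φstar x y + 291 * l * κ ^ 4 * τ₁ ^ 2 * σ ^ 2 := by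
    have hpot : (1 + β) * primal f x - Φstar - β * f x y =
        potential f Φstar x y - μ * τ₂ / 8 * gap := by
      unfold potential
      rw [hgap, hβ]
      ring
    have harith := step_arithmetic hl hκ1 hτ₁ hτ₁l (sq_nonneg ‖p‖) (sq_nonneg ‖q‖) hgap0
      (sq_nonneg σ) (hμτ₂ ▸ hβ) hbias
    rw [hpot, hμτ₂, hn, hτ₂]
    linarith
  calc _ ≤ _ := add_le_add_left ((lintegral_mono hinner).trans hR) _
    _ = ENNReal.ofReal (_ + τ₁ / 2 * ‖p‖ ^ 2) := (ENNReal.ofReal_add hR0 (by positivity)).symm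
    _ ≤ _ := ENNReal.ofReal_le_ofReal hbound
    _ = _ := ENNReal.ofReal_add (potential_nonneg hp hΦ x y) (by positivity)

end Step

/-! ### Independence of the iterates and the fresh samples -/

section Samples

variable {Ω Ξ : Type*} [MeasurableSpace Ξ] {ξ : ℕ → Fin 2 → Ω → Ξ}

/-- The σ-algebra generated by the samples with index in `S`. -/
abbrev samplesSigma (ξ : ℕ → Fin 2 → Ω → Ξ) (S : Set (ℕ × Fin 2)) : MeasurableSpace Ω :=
  ⨆ p ∈ S, MeasurableSpace.comap (ξ p.1 p.2) inferInstance

theorem samplesSigma_mono {S T : Set (ℕ × Fin 2)} (h : S ⊆ T) :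
    samplesSigma ξ S ≤ samplesSigma ξ T :=
  biSup_mono h

theorem measurable_samplesSigma {S : Set (ℕ × Fin 2)} {t : ℕ} {i : Fin 2} (h : (t, i) ∈ S) :
    Measurable[samplesSigma ξ S] (ξ t i) :=
  (comap_measurable (ξ t i)).mono
    (le_iSup₂_of_le (f := fun (p : ℕ × Fin 2) (_ : p ∈ S) =>
      MeasurableSpace.comap (ξ p.1 p.2) inferInstance) (t, i) h le_rfl) le_rfl

variable [MeasurableSpace Ω] {P : Measure Ω} {D : Measure Ξ}

theorem IsIID.samplesSigma_le (h : IsIID P D ξ) (S : Set (ℕ × Fin 2)) :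
    samplesSigma ξ S ≤ ‹MeasurableSpace Ω› :=
  iSup₂_le fun p _ => (h.measurable p.1 p.2).comap_le

/-- Fresh samples can be integrated out with the past held fixed. -/
theorem IsIID.lintegral_fresh [IsProbabilityMeasure P] [IsProbabilityMeasure D]
    (h : IsIID P D ξ) {β : Type*} [MeasurableSpace β] {Z : Ω → β} {t : ℕ}
    (hZ : Measurable[samplesSigma ξ {p | p.1 < t}] Z) {H : β × Ξ × Ξ → ℝ≥0∞}
    (hH : Measurable H) :
    ∫⁻ ω, H (Z ω, ξ t 0 ω, ξ t 1 ω) ∂P = ∫⁻ ω, ∫⁻ s₀, ∫⁻ s₁, H (Z ω, s₀, s₁) ∂D ∂D ∂P := by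
  have hZm : Measurable Z := hZ.mono (h.samplesSigma_le _) le_rfl
  have hξm : Measurable fun ω => (ξ t 0 ω, ξ t 1 ω) := (h.measurable t 0).prodMk (h.measurable t 1)
  have hpair : P.map (fun ω => (ξ t 0 ω, ξ t 1 ω)) = D.prod D := by
    have hi : ξ t 0 ⟂ᵢ[P] ξ t 1 :=
      h.indep.indepFun (i := (t, 0)) (j := (t, 1)) (by simp)
    rw [(indepFun_iff_map_prod_eq_prod_map_map (h.measurable t 0).aemeasurable
      (h.measurable t 1).aemeasurable).1 hi, h.law, h.law]
  have hind : Z ⟂ᵢ[P] fun ω => (ξ t 0 ω, ξ t 1 ω) := by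
    have hdisj : Disjoint {p : ℕ × Fin 2 | p.1 < t} {p | p.1 = t} :=
      Set.disjoint_left.2 fun p (hp : p.1 < t) (hp' : p.1 = t) => hp.ne hp'
    have hI := indep_iSup_of_disjoint (fun p : ℕ × Fin 2 => (h.measurable p.1 p.2).comap_le)
      ((iIndepFun_iff_iIndep _ _ P).1 h.indep) hdisj
    rw [IndepFun_iff_Indep]
    refine indep_of_indep_of_le_left (indep_of_indep_of_le_right hI ?_) hZ.comap_le
    exact Measurable.comap_le (m₁ := samplesSigma ξ {p | p.1 = t})
      (Measurable.prodMk (measurable_samplesSigma rfl) (measurable_samplesSigma rfl))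
  calc ∫⁻ ω, H (Z ω, ξ t 0 ω, ξ t 1 ω) ∂P
      = ∫⁻ w, H w ∂(P.map fun ω => (Z ω, ξ t 0 ω, ξ t 1 ω)) :=
        (lintegral_map hH (hZm.prodMk hξm)).symm
    _ = ∫⁻ w, H w ∂((P.map Z).prod (D.prod D)) := by
        rw [(indepFun_iff_map_prod_eq_prod_map_map hZm.aemeasurable hξm.aemeasurable).1 hind,
          hpair]
    _ = ∫⁻ z, ∫⁻ s, H (z, s) ∂(D.prod D) ∂(P.map Z) := lintegral_prod _ hH.aemeasurable
    _ = ∫⁻ ω, ∫⁻ s, H (Z ω, s) ∂(D.prod D) ∂P :=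
        lintegral_map hH.lintegral_prod_right' hZm
    _ = _ := lintegral_congr fun ω => lintegral_prod _ (hH.comp measurable_prodMk_left).aemeasurable

end Samples

/-! ### Convergence of the iterates -/

section Iterates

variable {d₁ d₂ : ℕ} {Ω Ξ : Type*} {ξ : ℕ → Fin 2 → Ω → Ξ}
  {Gx : Euc d₁ → Euc d₂ → Ξ → Euc d₁} {Gy : Euc d₁ → Euc d₂ → Ξ → Euc d₂}
  {τ₁ τ₂ : ℝ} {x₀ : Euc d₁} {y₀ : Euc d₂}

/-- The pair of iterates of Stoc-AGDA after `t` iterations, as a random variable. -/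
noncomputable def iterates (Gx : Euc d₁ → Euc d₂ → Ξ → Euc d₁) (Gy : Euc d₁ → Euc d₂ → Ξ → Euc d₂)
    (τ₁ τ₂ : ℝ) (x₀ : Euc d₁) (y₀ : Euc d₂) (ξ : ℕ → Fin 2 → Ω → Ξ) (t : ℕ) (ω : Ω) :
    Euc d₁ × Euc d₂ :=
  let S := stocAGDA Gx Gy τ₁ τ₂ x₀ y₀ (fun k i => ξ k i ω) t
  (S.x, S.y)

/-- One iteration of Stoc-AGDA as a map of the current iterates and the two samples. -/
noncomputable def iterationMap (Gx : Euc d₁ → Euc d₂ → Ξ → Euc d₁)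
    (Gy : Euc d₁ → Euc d₂ → Ξ → Euc d₂) (τ₁ τ₂ : ℝ) (w : (Euc d₁ × Euc d₂) × Ξ × Ξ) : Euc d₁ × Euc d₂ :=
  (w.1.1 - τ₁ • Gx w.1.1 w.1.2 w.2.1,
    w.1.2 + τ₂ • Gy (w.1.1 - τ₁ • Gx w.1.1 w.1.2 w.2.1) w.1.2 w.2.2)

theorem iterates_succ (t : ℕ) (ω : Ω) :
    iterates Gx Gy τ₁ τ₂ x₀ y₀ ξ (t + 1) ω =
      iterationMap Gx Gy τ₁ τ₂ (iterates Gx Gy τ₁ τ₂ x₀ y₀ ξ t ω, ξ t 0 ω, ξ t 1 ω) := rfl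

theorem stocAGDA_samples (s : ℕ → Fin 2 → Ξ) (t : ℕ) :
    (stocAGDA Gx Gy τ₁ τ₂ x₀ y₀ s t).samples = 2 * t := by
  induction t with
  | zero => rfl
  | succ t ih => simp only [stocAGDA, ih]; ring

variable [MeasurableSpace Ξ]

theorem measurable_iterationMap
    (hGx : Measurable fun p : Euc d₁ × Euc d₂ × Ξ => Gx p.1 p.2.1 p.2.2)
    (hGy : Measurable fun p : Euc d₁ × Euc d₂ × Ξ => Gy p.1 p.2.1 p.2.2) :
    Measurable (iterationMap Gx Gy τ₁ τ₂) := by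
  have hx : Measurable fun w : (Euc d₁ × Euc d₂) × Ξ × Ξ =>
      w.1.1 - τ₁ • Gx w.1.1 w.1.2 w.2.1 :=
    measurable_fst.fst.sub ((hGx.comp (measurable_fst.fst.prodMk
      (measurable_fst.snd.prodMk measurable_snd.fst))).const_smul τ₁)
  exact hx.prodMk (measurable_fst.snd.add ((hGy.comp (hx.prodMk
    (measurable_fst.snd.prodMk measurable_snd.snd))).const_smul τ₂))

theorem measurable_iterates_samplesSigma
    (hGx : Measurable fun p : Euc d₁ × Euc d₂ × Ξ => Gx p.1 p.2.1 p.2.2)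
    (hGy : Measurable fun p : Euc d₁ × Euc d₂ × Ξ => Gy p.1 p.2.1 p.2.2) (t : ℕ) :
    Measurable[samplesSigma ξ {p | p.1 < t}] (iterates Gx Gy τ₁ τ₂ x₀ y₀ ξ t) := by
  induction t with
  | zero => exact measurable_const (a := (x₀, y₀))
  | succ t ih =>
    have h1 := ih.mono (samplesSigma_mono (T := {p : ℕ × Fin 2 | p.1 < t + 1})
      fun p (hp : p.1 < t) => Nat.lt_succ_of_lt hp) le_rfl
    have h2 : ∀ i, Measurable[samplesSigma ξ {p | p.1 < t + 1}] (ξ t i) := fun i =>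
      measurable_samplesSigma (Nat.lt_succ_self t)
    exact (measurable_iterationMap hGx hGy).comp (h1.prodMk ((h2 0).prodMk (h2 1)))

variable [MeasurableSpace Ω] {P : Measure Ω} [IsProbabilityMeasure P] {D : Measure Ξ}
  [IsProbabilityMeasure D]

/-- Telescoped decrease of the potential over `T` iterations. -/
theorem sum_lintegral_gradient_le {f : Euc d₁ → Euc d₂ → ℝ} {l μ σ : ℝ}
    (hf : IsLipschitzSmooth f l) (hp : IsPL f μ) (hμl : μ ≤ l)
    (hGx : IsStochasticGradient D Gx (gradX f) σ) (hGy : IsStochasticGradient D Gy (gradY f) σ)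
    (hξ : IsIID P D ξ) {Φstar κ : ℝ} (hΦ : ∀ x, Φstar ≤ primal f x) (hκ : κ = l / μ)
    (hτ₁ : 0 < τ₁) (hτ₁l : 68 * (l * κ ^ 2 * τ₁) ≤ 1) (hτ₂ : τ₂ = 68 * κ ^ 2 * τ₁) (T : ℕ) :
    (∫⁻ ω, ENNReal.ofReal (potential f Φstar (iterates Gx Gy τ₁ τ₂ x₀ y₀ ξ T ω).1
        (iterates Gx Gy τ₁ τ₂ x₀ y₀ ξ T ω).2) ∂P) +
      ∑ t ∈ Finset.range T, ∫⁻ ω, ENNReal.ofReal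
        (τ₁ / 2 * ‖gradient (primal f) (iterates Gx Gy τ₁ τ₂ x₀ y₀ ξ t ω).1‖ ^ 2) ∂P ≤
      ENNReal.ofReal (potential f Φstar x₀ y₀) +
        T * ENNReal.ofReal (291 * l * κ ^ 4 * τ₁ ^ 2 * σ ^ 2) := by
  have hpot : Measurable fun w : Euc d₁ × Euc d₂ =>
      ENNReal.ofReal (potential f Φstar w.1 w.2) := by
    have h1 : Measurable (primal f) := (differentiable_primal hf hp hμl).continuous.measurable
    have h2 : Measurable fun w : Euc d₁ × Euc d₂ => f w.1 w.2 :=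
      hf.differentiable.continuous.measurable
    have h3 : Measurable fun w : Euc d₁ × Euc d₂ => primal f w.1 := h1.comp measurable_fst
    exact ((h3.sub_const Φstar).add ((h3.sub h2).div_const 8)).ennreal_ofReal
  induction T with
  | zero => simp [iterates, stocAGDA]
  | succ T ih =>
    have hz := measurable_iterates_samplesSigma (ξ := ξ) (τ₁ := τ₁) (τ₂ := τ₂) (x₀ := x₀)
      (y₀ := y₀) hGx.measurable hGy.measurable T
    have hzm := hz.mono (hξ.samplesSigma_le _) le_rfl
    have hgm : Measurable fun ω => ENNReal.ofReal
        (τ₁ / 2 * ‖gradient (primal f) (iterates Gx Gy τ₁ τ₂ x₀ y₀ ξ T ω).1‖ ^ 2) :=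
      ((((measurable_gradient_primal f).comp hzm.fst).norm.pow_const 2).const_mul
        (τ₁ / 2)).ennreal_ofReal
    have hstep : (∫⁻ ω, ENNReal.ofReal (potential f Φstar
          (iterates Gx Gy τ₁ τ₂ x₀ y₀ ξ (T + 1) ω).1
          (iterates Gx Gy τ₁ τ₂ x₀ y₀ ξ (T + 1) ω).2) ∂P) +
        ∫⁻ ω, ENNReal.ofReal
          (τ₁ / 2 * ‖gradient (primal f) (iterates Gx Gy τ₁ τ₂ x₀ y₀ ξ T ω).1‖ ^ 2) ∂P ≤
        (∫⁻ ω, ENNReal.ofReal (potential f Φstar (iterates Gx Gy τ₁ τ₂ x₀ y₀ ξ T ω).1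
          (iterates Gx Gy τ₁ τ₂ x₀ y₀ ξ T ω).2) ∂P) +
          ENNReal.ofReal (291 * l * κ ^ 4 * τ₁ ^ 2 * σ ^ 2) := by
      have hfresh := hξ.lintegral_fresh hz
        (hpot.comp (measurable_iterationMap (τ₁ := τ₁) (τ₂ := τ₂) hGx.measurable hGy.measurable))
      simp only [iterates_succ]
      simp only [Function.comp_apply] at hfresh
      rw [hfresh, ← lintegral_add_right _ hgm]
      calc _ ≤ ∫⁻ ω, (ENNReal.ofReal (potential f Φstar (iterates Gx Gy τ₁ τ₂ x₀ y₀ ξ T ω).1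
            (iterates Gx Gy τ₁ τ₂ x₀ y₀ ξ T ω).2) +
            ENNReal.ofReal (291 * l * κ ^ 4 * τ₁ ^ 2 * σ ^ 2)) ∂P :=
            lintegral_mono fun ω =>
              lintegral_potential_step_le hf hp hμl hGx hGy hΦ hκ hτ₁ hτ₁l hτ₂ _ _
        _ = _ := by rw [lintegral_add_right _ measurable_const]; simp
    rw [Finset.sum_range_succ, add_comm (∑ t ∈ _, _), ← add_assoc]
    calc _ ≤ _ := add_le_add_left hstep _
      _ = _ := add_right_comm _ _ _
      _ ≤ _ := add_le_add_left ih _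
      _ = _ := by push_cast; ring

theorem integrable_and_sum_integral_gradient_le {f : Euc d₁ → Euc d₂ → ℝ} {l μ σ : ℝ}
    (hf : IsLipschitzSmooth f l) (hp : IsPL f μ) (hμl : μ ≤ l)
    (hGx : IsStochasticGradient D Gx (gradX f) σ) (hGy : IsStochasticGradient D Gy (gradY f) σ)
    (hξ : IsIID P D ξ) {Φstar κ : ℝ} (hΦ : ∀ x, Φstar ≤ primal f x) (hκ : κ = l / μ)
    (hτ₁ : 0 < τ₁) (hτ₁l : 68 * (l * κ ^ 2 * τ₁) ≤ 1) (hτ₂ : τ₂ = 68 * κ ^ 2 * τ₁) (T : ℕ) :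
    (∀ t < T, Integrable
      (fun ω => ‖gradient (primal f) (iterates Gx Gy τ₁ τ₂ x₀ y₀ ξ t ω).1‖ ^ 2) P) ∧
    τ₁ / 2 * ∑ t ∈ Finset.range T,
        ∫ ω, ‖gradient (primal f) (iterates Gx Gy τ₁ τ₂ x₀ y₀ ξ t ω).1‖ ^ 2 ∂P ≤
      potential f Φstar x₀ y₀ + T * (291 * l * κ ^ 4 * τ₁ ^ 2 * σ ^ 2) := by
  have hl := hf.pos
  have hV := potential_nonneg hp hΦ x₀ y₀
  have hn : 0 ≤ 291 * l * κ ^ 4 * τ₁ ^ 2 * σ ^ 2 := by positivity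
  have hsum := le_add_self.trans
    (sum_lintegral_gradient_le (x₀ := x₀) (y₀ := y₀) hf hp hμl hGx hGy hξ hΦ hκ hτ₁ hτ₁l hτ₂ T)
  rw [← ENNReal.ofReal_natCast, ← ENNReal.ofReal_mul T.cast_nonneg,
    ← ENNReal.ofReal_add hV (by positivity)] at hsum
  have hint : ∀ t < T, Integrable (fun ω =>
      τ₁ / 2 * ‖gradient (primal f) (iterates Gx Gy τ₁ τ₂ x₀ y₀ ξ t ω).1‖ ^ 2) P := by
    intro t ht
    have hz := (measurable_iterates_samplesSigma (ξ := ξ) (τ₁ := τ₁) (τ₂ := τ₂) (x₀ := x₀)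
      (y₀ := y₀) hGx.measurable hGy.measurable t).mono (hξ.samplesSigma_le _) le_rfl
    refine (lintegral_ofReal_ne_top_iff_integrable
      ((((measurable_gradient_primal f).comp hz.fst).norm.pow_const 2).const_mul
        (τ₁ / 2)).aestronglyMeasurable
      (Eventually.of_forall fun ω => by simp only [Pi.zero_apply]; positivity)).1
      (ne_top_of_le_ne_top ENNReal.ofReal_ne_top ((Finset.single_le_sum
        (fun _ _ => zero_le) (Finset.mem_range.2 ht)).trans hsum))
  refine ⟨fun t ht => ?_, ?_⟩
  · exact (integrable_const_mul_iff (by positivity : τ₁ / 2 ≠ 0).isUnit _).1 (hint t ht)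
  · rw [← ENNReal.ofReal_le_ofReal_iff (by positivity), Finset.mul_sum,
      ENNReal.ofReal_sum_of_nonneg fun t _ =>
        mul_nonneg (by positivity) (integral_nonneg fun ω => by positivity)]
    refine (le_of_eq (Finset.sum_congr rfl fun t ht => ?_)).trans hsum
    rw [← integral_const_mul, ofReal_integral_eq_lintegral_ofReal
      (hint t (Finset.mem_range.1 ht)) (Eventually.of_forall fun ω => by
        simp only [Pi.zero_apply]; positivity)]

end Iterates

/-- Averaging over the uniform random index of the output. -/
theorem integral_outputMeasure {Ω : Type*} [MeasurableSpace Ω] {P : Measure Ω}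
    [IsProbabilityMeasure P] {T : ℕ} (hT : 1 ≤ T) {g : Fin T → Ω → ℝ}
    (hgm : ∀ i, Measurable (g i)) (hg : ∀ i, Integrable (g i) P) :
    Integrable (fun p : Ω × Fin T => g p.2 p.1) (outputMeasure P T) ∧
      ∫ p, g p.2 p.1 ∂(outputMeasure P T) = 1 / (T : ℝ) * ∑ i, ∫ ω, g i ω ∂P := by
  have : Nonempty (Fin T) := ⟨⟨0, hT⟩⟩
  have : IsProbabilityMeasure (uniformOn (Set.univ : Set (Fin T))) :=
    isProbabilityMeasure_uniformOn Set.finite_univ Set.univ_nonempty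
  have hm : Measurable fun p : Ω × Fin T => g p.2 p.1 :=
    measurable_from_prod_countable_left fun i => hgm i
  have hint : Integrable (fun p : Ω × Fin T => g p.2 p.1) (outputMeasure P T) :=
    (integrable_prod_iff' hm.aestronglyMeasurable).2
      ⟨Eventually.of_forall hg, Integrable.of_finite⟩
  refine ⟨hint, ?_⟩
  have hw : ∀ i : Fin T, (uniformOn (Set.univ : Set (Fin T))).real {i} = 1 / (T : ℝ) := by
    intro i
    rw [measureReal_def, uniformOn_univ]
    simp
  rw [outputMeasure, integral_prod_symm _ hint, integral_fintype Integrable.of_finite,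
    Finset.mul_sum]
  exact Finset.sum_congr rfl fun i _ => by rw [hw, smul_eq_mul]

/-! ### Step sizes and the final estimates -/

section Rates

variable {l κ σ Δ : ℝ} {T : ℕ}

theorem stepX_pos (hl : 0 < l) (hκ : 0 < κ) (hσ : 0 < σ) (hΔ : 0 < Δ) (hT : 1 ≤ T) :
    0 < stepX l κ σ Δ T := by
  have hT0 : (0 : ℝ) < T := by exact_mod_cast hT
  exact lt_min (by positivity) (by positivity)

theorem stepX_le (hl : 0 < l) (hκ : 0 < κ) : 68 * (l * κ ^ 2 * stepX l κ σ Δ T) ≤ 1 := by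
  have h : stepX l κ σ Δ T ≤ 1 / (68 * l * κ ^ 2) := min_le_right _ _
  rw [le_div_iff₀ (by positivity)] at h
  linarith

theorem stepY_eq (hκ : 0 < κ) : stepY l σ Δ T = 68 * κ ^ 2 * stepX l κ σ Δ T := by
  rw [stepX, stepY, mul_min_of_nonneg _ _ (by positivity)]
  congr 1
  · field_simp
    ring
  · field_simp

theorem sum_le_rate (hl : 0 < l) (hκ : 0 < κ) (hσ : 0 < σ) (hΔ : 0 < Δ) (hT : 1 ≤ T)
    {a₀ S : ℝ} (ha : 0 ≤ a₀)
    (hS : stepX l κ σ Δ T / 2 * S ≤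
      (Δ + a₀ / 8) + T * (291 * l * κ ^ 4 * stepX l κ σ Δ T ^ 2 * σ ^ 2)) :
    1 / (T : ℝ) * S ≤ 1088 * l * κ ^ 2 / T * Δ + 136 * l * κ ^ 2 / T * a₀ +
      8 * κ ^ 2 * √l * a₀ / √(Δ * T) * σ + 1232 * κ ^ 2 * √(l * Δ) / √T * σ := by
  have hT0 : (0 : ℝ) < T := by exact_mod_cast hT
  set τ := stepX l κ σ Δ T with hτ
  have hτ0 : 0 < τ := stepX_pos hl hκ hσ hΔ hT
  have hτ1 : τ ≤ √Δ / (4 * σ * κ ^ 2 * √(T * l)) := min_le_left _ _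
  have hinv : 1 / τ ≤ (4 * σ * κ ^ 2 * √(T * l)) / √Δ + 68 * l * κ ^ 2 := by
    rcases min_choice (√Δ / (4 * σ * κ ^ 2 * √(T * l))) (1 / (68 * l * κ ^ 2)) with h | h
    · rw [hτ, stepX, h, one_div_div]
      exact le_add_of_nonneg_right (by positivity)
    · rw [hτ, stepX, h, one_div_div, div_one]
      exact le_add_of_nonneg_left (by positivity)
  rw [Real.sqrt_mul hT0.le] at hτ1 hinv
  rw [Real.sqrt_mul hΔ.le, Real.sqrt_mul hl.le]
  have hT2 : (T : ℝ) = √T ^ 2 := (Real.sq_sqrt hT0.le).symm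
  have hl2 : l = √l ^ 2 := (Real.sq_sqrt hl.le).symm
  have hΔ2 : Δ = √Δ ^ 2 := (Real.sq_sqrt hΔ.le).symm
  have hsT : 0 < √(T : ℝ) := Real.sqrt_pos.2 hT0
  have hsl : 0 < √l := Real.sqrt_pos.2 hl
  have hsΔ : 0 < √Δ := Real.sqrt_pos.2 hΔ
  have h1 : 1 / (T : ℝ) * S ≤
      2 / T * (Δ + a₀ / 8) * (1 / τ) + 582 * l * κ ^ 4 * σ ^ 2 * τ := by
    have : S ≤ (2 / τ) * ((Δ + a₀ / 8) + T * (291 * l * κ ^ 4 * τ ^ 2 * σ ^ 2)) := by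
      rw [div_mul_eq_mul_div, le_div_iff₀ hτ0]
      linarith
    calc 1 / (T : ℝ) * S
        ≤ 1 / T * ((2 / τ) * ((Δ + a₀ / 8) + T * (291 * l * κ ^ 4 * τ ^ 2 * σ ^ 2))) := by
          gcongr
      _ = _ := by field_simp; ring
  have h2 : 2 / T * (Δ + a₀ / 8) * (1 / τ) ≤
      2 / T * (Δ + a₀ / 8) * ((4 * σ * κ ^ 2 * (√T * √l)) / √Δ + 68 * l * κ ^ 2) := by
    gcongr
  have h3 : 582 * l * κ ^ 4 * σ ^ 2 * τ ≤
      582 * l * κ ^ 4 * σ ^ 2 * (√Δ / (4 * σ * κ ^ 2 * (√T * √l))) := by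
    gcongr
  have h4 : 582 * l * κ ^ 4 * σ ^ 2 * (√Δ / (4 * σ * κ ^ 2 * (√T * √l))) =
      145.5 * (κ ^ 2 * (√l * √Δ) / √T * σ) := by
    nth_rewrite 1 [hl2]
    field_simp
    norm_num
  have h5 : 2 / T * (Δ + a₀ / 8) * ((4 * σ * κ ^ 2 * (√T * √l)) / √Δ + 68 * l * κ ^ 2) =
      136 * (l * κ ^ 2 / T * Δ) + 17 * (l * κ ^ 2 / T * a₀) +
        8 * (κ ^ 2 * (√l * √Δ) / √T * σ) + κ ^ 2 * √l * a₀ / (√Δ * √T) * σ := by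
    have e1 : 2 / (T : ℝ) * Δ * ((4 * σ * κ ^ 2 * (√T * √l)) / √Δ) =
        8 * (κ ^ 2 * (√l * √Δ) / √T * σ) := by
      nth_rewrite 1 [hT2]
      nth_rewrite 1 [hΔ2]
      field_simp
      ring
    have e2 : 2 / (T : ℝ) * (a₀ / 8) * ((4 * σ * κ ^ 2 * (√T * √l)) / √Δ) =
        κ ^ 2 * √l * a₀ / (√Δ * √T) * σ := by
      nth_rewrite 1 [hT2]
      field_simp
      ring
    have e3 : 2 / (T : ℝ) * (Δ + a₀ / 8) * (68 * l * κ ^ 2) =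
        136 * (l * κ ^ 2 / T * Δ) + 17 * (l * κ ^ 2 / T * a₀) := by ring
    linear_combination e1 + e2 + e3
  have p1 : 0 ≤ l * κ ^ 2 / T * Δ := by positivity
  have p2 : 0 ≤ l * κ ^ 2 / T * a₀ := by positivity
  have p3 : 0 ≤ κ ^ 2 * (√l * √Δ) / √T * σ := by positivity
  have p4 : 0 ≤ κ ^ 2 * √l * a₀ / (√Δ * √T) * σ := by positivity
  calc 1 / (T : ℝ) * S ≤ _ := h1.trans (add_le_add (h2.trans h5.le) (h3.trans h4.le))
    _ ≤ 1088 * (l * κ ^ 2 / T * Δ) + 136 * (l * κ ^ 2 / T * a₀) +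
        8 * (κ ^ 2 * √l * a₀ / (√Δ * √T) * σ) +
        1232 * (κ ^ 2 * (√l * √Δ) / √T * σ) := by linarith
    _ = _ := by ring

/-- The constant is chosen so that each of the two parts of the rate is at most `ε² / 2`. -/
theorem rate_le_sq (hl : 0 < l) (hκ : 0 < κ) (hσ : 0 < σ) (hΔ : 0 < Δ) (hT : 1 ≤ T)
    {a₀ A ε : ℝ} (hA : 1 ≤ A) (haA : a₀ ≤ A * Δ) (hε : 0 < ε)
    (hN : 8 * 1240 ^ 2 * (A * (l * κ ^ 2 * Δ / ε ^ 2) +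
      A ^ 2 * (l * κ ^ 4 * Δ * σ ^ 2 / ε ^ 4)) ≤ 2 * T) :
    1088 * l * κ ^ 2 / T * Δ + 136 * l * κ ^ 2 / T * a₀ +
      8 * κ ^ 2 * √l * a₀ / √(Δ * T) * σ + 1232 * κ ^ 2 * √(l * Δ) / √T * σ ≤ ε ^ 2 := by
  have hT0 : (0 : ℝ) < T := by exact_mod_cast hT
  have hA0 : 0 < A := by linarith
  have hsT : 0 < √(T : ℝ) := Real.sqrt_pos.2 hT0
  have hsl : 0 < √l := Real.sqrt_pos.2 hl
  have hsΔ : 0 < √Δ := Real.sqrt_pos.2 hΔ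
  rw [Real.sqrt_mul hΔ.le, Real.sqrt_mul hl.le]
  set X := A * (l * κ ^ 2 * Δ) with hX
  set Y := A * (κ ^ 2 * (√l * √Δ) * σ) with hY
  have hX0 : 0 < X := by positivity
  have hY0 : 0 < Y := by positivity
  have hY2 : A ^ 2 * (l * κ ^ 4 * Δ * σ ^ 2 / ε ^ 4) = (Y / ε ^ 2) ^ 2 := by
    rw [hY]
    simp only [div_pow, mul_pow, Real.sq_sqrt hl.le, Real.sq_sqrt hΔ.le]
    ring
  rw [hY2, ← mul_div_assoc, ← hX] at hN
  have hq : 0 < X / ε ^ 2 := by positivity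
  have hT1 : 2448 * (X / ε ^ 2) ≤ T := by nlinarith [sq_nonneg (Y / ε ^ 2)]
  have hT2 : 2480 * (Y / ε ^ 2) ≤ √T := by
    refine Real.le_sqrt_of_sq_le ?_
    nlinarith
  have b1 : 1224 * (X / T) ≤ ε ^ 2 / 2 := by
    rw [mul_div_assoc', div_le_div_iff₀ hT0 two_pos]
    rw [mul_div_assoc', div_le_iff₀ (by positivity)] at hT1
    linarith
  have b2 : 1240 * (Y / √T) ≤ ε ^ 2 / 2 := by
    rw [mul_div_assoc', div_le_div_iff₀ hsT two_pos]
    rw [mul_div_assoc', div_le_iff₀ (by positivity)] at hT2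
    linarith
  have c1 : 1088 * l * κ ^ 2 / T * Δ ≤ 1088 * (X / T) := by
    calc 1088 * l * κ ^ 2 / T * Δ = 1088 * (1 * (l * κ ^ 2 * Δ) / T) := by ring
      _ ≤ 1088 * (A * (l * κ ^ 2 * Δ) / T) := by gcongr
  have c2 : 136 * l * κ ^ 2 / T * a₀ ≤ 136 * (X / T) := by
    calc 136 * l * κ ^ 2 / T * a₀ ≤ 136 * l * κ ^ 2 / T * (A * Δ) := by gcongr
      _ = 136 * (X / T) := by rw [hX]; ring
  have c3 : 8 * κ ^ 2 * √l * a₀ / (√Δ * √T) * σ ≤ 8 * (Y / √T) := by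
    calc 8 * κ ^ 2 * √l * a₀ / (√Δ * √T) * σ
        ≤ 8 * κ ^ 2 * √l * (A * √Δ ^ 2) / (√Δ * √T) * σ := by
          rw [Real.sq_sqrt hΔ.le]
          gcongr
      _ = 8 * (Y / √T) := by rw [hY]; field_simp
  have c4 : 1232 * κ ^ 2 * (√l * √Δ) / √T * σ ≤ 1232 * (Y / √T) := by
    calc 1232 * κ ^ 2 * (√l * √Δ) / √T * σ
        = 1232 * (1 * (κ ^ 2 * (√l * √Δ) * σ) / √T) := by ring
      _ ≤ 1232 * (A * (κ ^ 2 * (√l * √Δ) * σ) / √T) := by gcongr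
  linarith

end Rates

theorem isStationaryInExpectation_of_sq_le {d : ℕ} {Ω : Type*} [MeasurableSpace Ω]
    {Q : Measure Ω} [IsProbabilityMeasure Q] {Φ : Euc d → ℝ} {X : Ω → Euc d} {ε : ℝ}
    (hm : AEStronglyMeasurable (fun ω => ‖gradient Φ (X ω)‖) Q)
    (hint : Integrable (fun ω => ‖gradient Φ (X ω)‖ ^ 2) Q)
    (hε : 0 < ε) (hle : ∫ ω, ‖gradient Φ (X ω)‖ ^ 2 ∂Q ≤ ε ^ 2) :
    IsStationaryInExpectation Q Φ X ε := by
  have hpt : ∀ ω, ‖gradient Φ (X ω)‖ ≤ ‖gradient Φ (X ω)‖ ^ 2 / (2 * ε) + ε / 2 := fun ω => by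
    rw [div_add_div _ _ (by positivity) two_ne_zero, le_div_iff₀ (by positivity)]
    nlinarith [sq_nonneg (‖gradient Φ (X ω)‖ - ε)]
  have hi : Integrable (fun ω => ‖gradient Φ (X ω)‖ ^ 2 / (2 * ε) + ε / 2) Q :=
    (hint.div_const _).add (integrable_const _)
  have hint1 : Integrable (fun ω => ‖gradient Φ (X ω)‖) Q :=
    hi.mono' hm (Eventually.of_forall fun ω => by simpa using hpt ω)
  refine ⟨hint, hle, hint1, (integral_mono hint1 hi hpt).trans ?_⟩
  rw [integral_add (hint.div_const _) (integrable_const _), integral_div, integral_const,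
    probReal_univ, one_smul]
  have : (∫ ω, ‖gradient Φ (X ω)‖ ^ 2 ∂Q) / (2 * ε) ≤ ε / 2 := by
    rw [div_le_div_iff₀ (by positivity) two_pos]
    nlinarith
  linarith

end NCPL

theorem theorem1 :
    -- `C` is an absolute constant: it is chosen before all the data of the problem
    ∃ C : ℝ, 0 < C ∧
      ∀ {d₁ d₂ : ℕ} {Ω Ξ : Type*} [MeasurableSpace Ω] [MeasurableSpace Ξ]
        (P : Measure Ω) [IsProbabilityMeasure P] (D : Measure Ξ) [IsProbabilityMeasure D]
        (f : Euc d₁ → Euc d₂ → ℝ) (l μ σ : ℝ)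
        (Gx : Euc d₁ → Euc d₂ → Ξ → Euc d₁) (Gy : Euc d₁ → Euc d₂ → Ξ → Euc d₂)
        (ξ : ℕ → Fin 2 → Ω → Ξ) (x₀ : Euc d₁) (y₀ : Euc d₂) (Φstar κ Δ a₀ : ℝ),
        IsLipschitzSmooth f l → IsPL f μ → μ ≤ l → 0 < σ →
        IsStochasticGradient D Gx (gradX f) σ → IsStochasticGradient D Gy (gradY f) σ →
        IsIID P D ξ →
        (∀ x, Φstar ≤ primal f x) →
        κ = l / μ → Δ = primal f x₀ - Φstar → 0 < Δ → a₀ = primal f x₀ - f x₀ y₀ →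
        -- the run of Stoc-AGDA with `T` iterations, looked at after `t` of them
        ∀ run : ℕ → ℕ → Ω → State d₁ d₂,
        (∀ T t ω, run T t ω =
          stocAGDA Gx Gy (stepX l κ σ Δ T) (stepY l σ Δ T) x₀ y₀ (fun k i => ξ k i ω) t) →
        Differentiable ℝ (primal f) ∧
        -- the convergence bound
        (∀ T : ℕ, 1 ≤ T →
          (∀ t, t < T → Integrable (fun ω => ‖gradient (primal f) (run T t ω).x‖ ^ 2) P) ∧
          (1 / (T : ℝ)) * ∑ t ∈ Finset.range T, ∫ ω, ‖gradient (primal f) (run T t ω).x‖ ^ 2 ∂P ≤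
            1088 * l * κ ^ 2 / T * Δ + 136 * l * κ ^ 2 / T * a₀ +
              8 * κ ^ 2 * √l * a₀ / √(Δ * T) * σ +
              1232 * κ ^ 2 * √(l * Δ) / √T * σ) ∧
        -- the sample complexity; `N` is the number of samples that suffices
        (∀ A ε N : ℝ, 1 ≤ A → a₀ ≤ A * Δ → 0 < ε →
          N = C * (A * (l * κ ^ 2 * Δ / ε ^ 2) + A ^ 2 * (l * κ ^ 4 * Δ * σ ^ 2 / ε ^ 4)) →
          (∀ T : ℕ, 1 ≤ T → (∀ ω, N ≤ (run T T ω).samples) →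
            IsStationaryInExpectation (outputMeasure P T) (primal f)
              (fun p => (run T p.2 p.1).x) ε) ∧
          (∃ T : ℕ, 1 ≤ T ∧ ∀ ω, N ≤ (run T T ω).samples ∧ ((run T T ω).samples : ℝ) ≤ N + 2)) := by
  refine ⟨8 * 1240 ^ 2, by norm_num, ?_⟩
  intro d₁ d₂ Ω Ξ _ _ P _ D _ f l μ σ Gx Gy ξ x₀ y₀ Φstar κ Δ a₀ hf hp hμl hσ hGx hGy hξ hΦ hκ hΔ
    hΔ0 ha₀ run hrun
  have hl := hf.pos
  have hκ0 : 0 < κ := by rw [hκ]; exact div_pos hl hp.pos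
  have ha0 : 0 ≤ a₀ := by rw [ha₀]; exact sub_nonneg.2 (hp.le_primal x₀ y₀)
  have hx : ∀ T t ω, (run T t ω).x =
      (iterates Gx Gy (stepX l κ σ Δ T) (stepY l σ Δ T) x₀ y₀ ξ t ω).1 := fun T t ω => by
    rw [hrun]; rfl
  have hsamp : ∀ T t ω, (run T t ω).samples = 2 * t := fun T t ω => by
    rw [hrun, stocAGDA_samples]
  have hbound : ∀ T : ℕ, 1 ≤ T →
      (∀ t, t < T → Integrable (fun ω => ‖gradient (primal f) (run T t ω).x‖ ^ 2) P) ∧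
      (1 / (T : ℝ)) * ∑ t ∈ Finset.range T, ∫ ω, ‖gradient (primal f) (run T t ω).x‖ ^ 2 ∂P ≤
        1088 * l * κ ^ 2 / T * Δ + 136 * l * κ ^ 2 / T * a₀ +
          8 * κ ^ 2 * √l * a₀ / √(Δ * T) * σ + 1232 * κ ^ 2 * √(l * Δ) / √T * σ := by
    intro T hT
    obtain ⟨hint, hsum⟩ := integrable_and_sum_integral_gradient_le (x₀ := x₀) (y₀ := y₀)
      hf hp hμl hGx hGy hξ hΦ hκ (stepX_pos hl hκ0 hσ hΔ0 hT) (stepX_le (T := T) hl hκ0)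
      (stepY_eq hκ0) T
    simp only [hx]
    refine ⟨hint, sum_le_rate hl hκ0 hσ hΔ0 hT ha0 ?_⟩
    rwa [potential, ← hΔ, ← ha₀] at hsum
  refine ⟨differentiable_primal hf hp hμl, hbound, ?_⟩
  intro A ε N hA haA hε hN
  refine ⟨fun T hT hdraw => ?_, ?_⟩
  · have : Nonempty Ω := P.nonempty_of_neZero
    obtain ⟨hint, hmean⟩ := hbound T hT
    have hNT : N ≤ 2 * T := by simpa [hsamp] using hdraw (Classical.arbitrary Ω)
    have hgm : ∀ i : Fin T, Measurable fun ω => ‖gradient (primal f) (run T i ω).x‖ := by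
      intro i
      simp only [hx]
      exact ((measurable_gradient_primal f).comp ((measurable_iterates_samplesSigma
        hGx.measurable hGy.measurable i).mono (hξ.samplesSigma_le _) le_rfl).fst).norm
    obtain ⟨hout, hout'⟩ := integral_outputMeasure hT (P := P)
      (g := fun i ω => ‖gradient (primal f) (run T i ω).x‖ ^ 2)
      (fun i => (hgm i).pow_const 2) (fun i => hint i i.2)
    have : Nonempty (Fin T) := ⟨⟨0, hT⟩⟩
    have : IsProbabilityMeasure (uniformOn (Set.univ : Set (Fin T))) :=
      isProbabilityMeasure_uniformOn Set.finite_univ Set.univ_nonempty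
    have : IsProbabilityMeasure (outputMeasure P T) := by
      unfold outputMeasure; infer_instance
    refine isStationaryInExpectation_of_sq_le ?_ hout hε ?_
    · exact (measurable_from_prod_countable_left (f := fun p : Ω × Fin T =>
        ‖gradient (primal f) (run T p.2 p.1).x‖) hgm).aestronglyMeasurable
    · rw [hout', Fin.sum_univ_eq_sum_range
        (fun i => ∫ ω, ‖gradient (primal f) (run T i ω).x‖ ^ 2 ∂P) T]
      exact hmean.trans (rate_le_sq hl hκ0 hσ hΔ0 hT hA haA hε (hN ▸ hNT))
  · have hN0 : 0 < N := by
      rw [hN]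
      have : 0 < A := by linarith
      positivity
    refine ⟨⌈N / 2⌉₊, Nat.one_le_iff_ne_zero.2 (Nat.ceil_pos.2 (by positivity)).ne', fun ω => ?_⟩
    rw [hsamp]
    have h1 := Nat.le_ceil (N / 2)
    have h2 := Nat.ceil_lt_add_one (by positivity : 0 ≤ N / 2)
    push_cast
    constructor <;> linarith
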